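/- **Setting.** Let $A=(A_{ij})$ be the Cartan matrix of a simply-laced Lie algebra $g$: a finite symmetric integer matrix with $A_{ii}=2$ and $A_{ij}\in\{0,-1\}$ for $i\ne j$; put $B_{ij}=A_{ij}/2$. Let $\hbar\neq 0$ and $\eta^{(n)}\neq 0$, $c_n$ ($n\in\mathbb Z$) be real numbers with $\frac1{\eta^{(n+1)}}-\frac1{\eta^{(n)}}=\hbar c_n$ for all $n$. For real $\eta\ne0$ and $c$ with $\frac1\eta+\hbar c\neq 0$ let $\eta'$ be given by $\frac1{\eta'}-\frac1\eta=\hbar c$. Let $\mathcal A_{\hbar,\eta}(\widehat g)_c$ be the formal current algebra at level $c$: the associative unital algebra generated by the currents $E_i(u),F_i(u),H_i^\pm(u)$ ($u\in\mathbb C$) and a central element, equal to the level $c$, with the relations $$H^+_i(u)H^-_j(v)=\tfrac{\mathrm{sh}\,\pi\eta(u-v-i\hbar(B_{ij}-c/2))}{\mathrm{sh}\,\pi\eta(u-v+i\hbar(B_{ij}+c/2))}\,\tfrac{\mathrm{sh}\,\pi\eta'(u-v+i\hbar(B_{ij}-c/2))}{\mathrm{sh}\,\pi\eta'(u-v-i\hbar(B_{ij}+c/2))}\,H^-_j(v)H^+_i(u),$$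 $$H^\pm_i(u)H^\pm_j(v)=\tfrac{\mathrm{sh}\,\pi\eta(u-v-i\hbar B_{ij})}{\mathrm{sh}\,\pi\eta(u-v+i\hbar B_{ij})}\,\tfrac{\mathrm{sh}\,\pi\eta'(u-v+i\hbar B_{ij})}{\mathrm{sh}\,\pi\eta'(u-v-i\hbar B_{ij})}\,H^\pm_j(v)H^\pm_i(u),$$ $$H^\pm_i(u)E_j(v)=\tfrac{\mathrm{sh}\,\pi\eta(u-v-i\hbar(B_{ij}\mp c/4))}{\mathrm{sh}\,\pi\eta(u-v+i\hbar(B_{ij}\pm c/4))}\,E_j(v)H^\pm_i(u),$$ $$H^\pm_i(u)F_j(v)=\tfrac{\mathrm{sh}\,\pi\eta'(u-v+i\hbar(B_{ij}\mp c/4))}{\mathrm{sh}\,\pi\eta'(u-v-i\hbar(B_{ij}\pm c/4))}\,F_j(v)H^\pm_i(u),$$ $$E_i(u)E_j(v)=\tfrac{\mathrm{sh}\,\pi\eta(u-v-i\hbar B_{ij})}{\mathrm{sh}\,\pi\eta(u-v+i\hbar B_{ij})}\,E_j(v)E_i(u),\qquad F_i(u)F_j(v)=\tfrac{\mathrm{sh}\,\pi\eta'(u-v+i\hbar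 B_{ij})}{\mathrm{sh}\,\pi\eta'(u-v-i\hbar B_{ij})}\,F_j(v)F_i(u),$$ $$[E_i(u),F_j(v)]=\tfrac{2\pi}{\hbar}\delta_{ij}\left[\delta(u-v-\tfrac{i\hbar c}2)H^+_i(u-\tfrac{i\hbar c}4)-\delta(u-v+\tfrac{i\hbar c}2)H^-_i(v-\tfrac{i\hbar c}4)\right],$$ and, whenever $A_{ij}=-1$, $$E_i(u_1)E_i(u_2)E_j(v)-2\cos(\pi\eta\hbar)E_i(u_1)E_j(v)E_i(u_2)+E_j(v)E_i(u_1)E_i(u_2)+(u_1\leftrightarrow u_2)=0,$$ together with the same relation for $F$ with $\eta'$ in place of $\eta$. Here $\delta$ is a formal delta function: the algebras are taken over $\mathbb C[\delta_0]$, with $\delta(0)=\delta_0$ and $\delta(z)=0$ for $z\neq0$. Exchange relations $XY=f(u-v)YX$ hold for all $u,v$, the meromorphic $f$ being evaluated as a limit, and read $YX=0$ at a pole of $f$; the Serre-like relations are imposed away from the zeros and poles of the $EE$ (respectively $FF$) structure functions of the three currents involved. Define $\Delta_n^+$ on generators, with values in $\mathcal A_{\hbar,\eta^{(n)}}(\widehat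 g)_{c_n}\otimes\mathcal A_{\hbar,\eta^{(n+1)}}(\widehat g)_{c_{n+1}}$ (tensor product over $\mathbb C[\delta_0]$), by $$c\mapsto c\otimes1+1\otimes c,\qquad H_i^\pm(u)\mapsto H_i^\pm(u\pm\tfrac{i\hbar c_{n+1}}4)\otimes H_i^\pm(u\mp\tfrac{i\hbar c_n}4),$$ $$E_i(u)\mapsto E_i(u)\otimes 1+H_i^-(u+\tfrac{i\hbar c_n}4)\otimes E_i(u+\tfrac{i\hbar c_n}2),$$ $$F_i(u)\mapsto 1\otimes F_i(u)+F_i(u+\tfrac{i\hbar c_{n+1}}2)\otimes H_i^+(u+\tfrac{i\hbar c_{n+1}}4),$$ and define $\Delta_n^-$ by the same formulas with $(n,n+1)$ replaced by $(n-1,n)$. **Proposition.** For every $n\in\mathbb Z$, the elements assigned to the generators by $\Delta_n^+$ satisfy all the defining relations of $\mathcal A_{\hbar,\eta^{(n)}}(\widehat g)_{c_n+c_{n+1}}$, including the Serre-like ones; hence $\Delta_n^+$ induces a unique algebra homomorphism $$\mathcal A_{\hbar,\eta^{(n)}}(\widehat g)_{c_n+c_{n+1}}\to\mathcal A_{\hbar,\eta^{(n)}}(\widehat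 g)_{c_n}\otimes\mathcal A_{\hbar,\eta^{(n+1)}}(\widehat g)_{c_{n+1}}.$$ Likewise $\Delta_n^-$ induces a unique algebra homomorphism $$\mathcal A_{\hbar,\eta^{(n-1)}}(\widehat g)_{c_{n-1}+c_n}\to\mathcal A_{\hbar,\eta^{(n-1)}}(\widehat g)_{c_{n-1}}\otimes\mathcal A_{\hbar,\eta^{(n)}}(\widehat g)_{c_n}.$$ -/

import Mathlib

open Filter Topology
open scoped TensorProduct

noncomputable section

namespace CurrentAlgebra

/-- The ground ring `ℂ[δ₀]`, a polynomial ring in one variable `δ₀`. The variable plays the role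
of the symbol `δ(0)` in formal current relations. -/
abbrev DeltaRing : Type := Polynomial ℂ

/-- The formal delta function: `δ(0)` is the indeterminate of the ground ring and `δ(z) = 0`
for `z ≠ 0`. -/
def delta (z : ℂ) : DeltaRing :=
  open Classical in if z = 0 then Polynomial.X else 0

/-- The sifting rule `φ(z) δ(z - a) = φ(a) δ(z - a)`, which is the way the delta function is used
in current relations. -/
theorem delta_sift {M : Type*} [AddCommGroup M] [Module DeltaRing M] (φ : ℂ → M) (z a : ℂ) :
    delta (z - a) • φ z = delta (z - a) • φ a := by
  by_cases h : z = a
  · rw [h]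
  · simp [delta, sub_eq_zero, h]

/-- The generators: the currents `E_i(u)`, `F_i(u)`, `H^±_i(u)` (with `i` a node of the Dynkin
diagram, `u` a complex spectral parameter, and the superscript `±` given as a unit of `ℤ`), and
the element `c`. -/
inductive Gen (ι : Type*) : Type _
  | E (i : ι) (u : ℂ) : Gen ι
  | F (i : ι) (u : ℂ) : Gen ι
  | H (ε : ℤˣ) (i : ι) (u : ℂ) : Gen ι
  | c : Gen ι

/-- The sign `±1` as a complex number. -/
def sgn (ε : ℤˣ) : ℂ := ((ε : ℤ) : ℂ)

/-- `sh (π η z)`. -/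
def sh (η : ℝ) (z : ℂ) : ℂ := Complex.sinh (Real.pi * η * z)

/-- The parameter `η'` determined by `1 / η' - 1 / η = ħ c`. -/
def etaPrime (ħ η c : ℝ) : ℝ := (1 / η + ħ * c)⁻¹

section Relations

variable {ι : Type*} (A : Matrix ι ι ℤ) (ħ η c : ℝ)

/-- `i ħ B_ij` and `i ħ c` are written `I * ħ * B A i j` and `I * ħ * c`; here `B_ij = A_ij / 2`. -/
def B (i j : ι) : ℂ := (A i j : ℂ) / 2

local notation "I" => Complex.I

/-- The structure functions. `Exch A ħ η c X Y f x` says that the defining relations contain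
`X Y = f(x) Y X`, where `f` is the (meromorphic) structure function of the pair of currents `X`,
`Y` and `x = u - v` is the difference of their spectral parameters. -/
inductive Exch : Gen ι → Gen ι → (ℂ → ℂ) → ℂ → Prop
  | HpHm (i j : ι) (u v : ℂ) :
      Exch (.H 1 i u) (.H (-1) j v)
        (fun x =>
          sh η (x - I * ħ * (B A i j - c / 2)) / sh η (x + I * ħ * (B A i j + c / 2)) *
          (sh (etaPrime ħ η c) (x + I * ħ * (B A i j - c / 2)) /
            sh (etaPrime ħ η c) (x - I * ħ * (B A i j + c / 2))))
        (u - v)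
  | HH (ε : ℤˣ) (i j : ι) (u v : ℂ) :
      Exch (.H ε i u) (.H ε j v)
        (fun x =>
          sh η (x - I * ħ * B A i j) / sh η (x + I * ħ * B A i j) *
          (sh (etaPrime ħ η c) (x + I * ħ * B A i j) /
            sh (etaPrime ħ η c) (x - I * ħ * B A i j)))
        (u - v)
  | HE (ε : ℤˣ) (i j : ι) (u v : ℂ) :
      Exch (.H ε i u) (.E j v)
        (fun x =>
          sh η (x - I * ħ * (B A i j - sgn ε * c / 4)) /
            sh η (x + I * ħ * (B A i j + sgn ε * c / 4)))
        (u - v)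
  | HF (ε : ℤˣ) (i j : ι) (u v : ℂ) :
      Exch (.H ε i u) (.F j v)
        (fun x =>
          sh (etaPrime ħ η c) (x + I * ħ * (B A i j - sgn ε * c / 4)) /
            sh (etaPrime ħ η c) (x - I * ħ * (B A i j + sgn ε * c / 4)))
        (u - v)
  | EE (i j : ι) (u v : ℂ) :
      Exch (.E i u) (.E j v)
        (fun x => sh η (x - I * ħ * B A i j) / sh η (x + I * ħ * B A i j))
        (u - v)
  | FF (i j : ι) (u v : ℂ) :
      Exch (.F i u) (.F j v)
        (fun x =>
          sh (etaPrime ħ η c) (x + I * ħ * B A i j) / sh (etaPrime ħ η c) (x - I * ħ * B A i j))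
        (u - v)

/-- `x` is neither a zero nor a pole of the function
`sh πη(x - iħ b) / sh πη(x + iħ b)`. -/
def Regular (b x : ℂ) : Prop :=
  sh η (x - I * ħ * b) ≠ 0 ∧ sh η (x + I * ħ * b) ≠ 0

/-- The left-hand side of the Serre-like relations, for `X₁ = X(u₁)`, `X₂ = X(u₂)`, `Y = Y(v)`,
with `η` the parameter in the coefficient `2 cos (π η ħ)`. -/
def serre {S : Type*} [Ring S] [Algebra DeltaRing S] (X₁ X₂ Y : S) : S :=
  (X₁ * X₂ * Y - (Polynomial.C (2 * Complex.cos (Real.pi * η * ħ)) : DeltaRing) • (X₁ * Y * X₂)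
      + Y * X₁ * X₂) +
  (X₂ * X₁ * Y - (Polynomial.C (2 * Complex.cos (Real.pi * η * ħ)) : DeltaRing) • (X₂ * Y * X₁)
      + Y * X₂ * X₁)

/-- The free algebra on the generators. -/
abbrev Free (ι : Type*) : Type _ := FreeAlgebra DeltaRing (Gen ι)

/-- A generator as an element of the free algebra. -/
abbrev fgen (g : Gen ι) : Free ι := FreeAlgebra.ι DeltaRing g

variable [DecidableEq ι]

/-- The defining relations of the current algebra at level `c`.

The exchange relations `X Y = f(x) Y X` are imposed at all values of the spectral parameters;
the value of the meromorphic function `f` at `x` is the limit there (so removable singularities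
are removed), and at a pole of `f` the relation reads `Y X = 0`, as `X Y = 0` at a zero of `f`.
The Serre-like relations are imposed away from the zeros and poles of the structure functions of
the three currents that they involve. -/
inductive Rel : Free ι → Free ι → Prop
  | exchange {X Y : Gen ι} {f : ℂ → ℂ} {x l : ℂ} (hf : Exch A ħ η c X Y f x)
      (hl : Tendsto f (𝓝[≠] x) (𝓝 l)) :
      Rel (fgen X * fgen Y) ((Polynomial.C l : DeltaRing) • (fgen Y * fgen X))
  | exchange_pole {X Y : Gen ι} {f : ℂ → ℂ} {x : ℂ} (hf : Exch A ħ η c X Y f x)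
      (hl : Tendsto f (𝓝[≠] x) (Bornology.cobounded ℂ)) :
      Rel (fgen Y * fgen X) 0
  | EF (i j : ι) (u v : ℂ) :
      Rel (fgen (.E i u) * fgen (.F j v) - fgen (.F j v) * fgen (.E i u))
        (if i = j then
          (Polynomial.C (2 * Real.pi / ħ : ℂ) : DeltaRing) •
            (delta (u - v - I * ħ * c / 2) • fgen (.H 1 i (u - I * ħ * c / 4))
              - delta (u - v + I * ħ * c / 2) • fgen (.H (-1) i (v - I * ħ * c / 4)))
        else 0)
  | serreE (i j : ι) (hij : A i j = -1) (u₁ u₂ v : ℂ)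
      (h₁₂ : Regular ħ η (B A i i) (u₁ - u₂))
      (h₁ : Regular ħ η (B A i j) (u₁ - v)) (h₂ : Regular ħ η (B A i j) (u₂ - v)) :
      Rel (serre ħ η (fgen (.E i u₁)) (fgen (.E i u₂)) (fgen (.E j v))) 0
  | serreF (i j : ι) (hij : A i j = -1) (u₁ u₂ v : ℂ)
      (h₁₂ : Regular ħ (etaPrime ħ η c) (B A i i) (u₁ - u₂))
      (h₁ : Regular ħ (etaPrime ħ η c) (B A i j) (u₁ - v))
      (h₂ : Regular ħ (etaPrime ħ η c) (B A i j) (u₂ - v)) :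
      Rel (serre ħ (etaPrime ħ η c) (fgen (.F i u₁)) (fgen (.F i u₂)) (fgen (.F j v))) 0
  | central (g : Gen ι) : Rel (fgen .c * fgen g) (fgen g * fgen .c)
  | level : Rel (fgen .c) (algebraMap DeltaRing (Free ι) (Polynomial.C (c : ℂ)))

/-- A family of elements of an algebra, indexed by the generators, satisfies the defining relations
of the current algebra with parameters `ħ`, `η` at level `c`. -/
def SatisfiesRelations {S : Type*} [Ring S] [Algebra DeltaRing S] (φ : Gen ι → S) : Prop :=
  ∀ x y : Free ι, Rel A ħ η c x y →
    FreeAlgebra.lift DeltaRing φ x = FreeAlgebra.lift DeltaRing φ y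

/-- The current algebra `A_{ħ,η}(ĝ)_c` at level `c`, for `g` with Cartan matrix `A`: the
associative unital algebra presented by the generators `Gen ι` and the relations `Rel`. -/
def Alg : Type _ := RingQuot (Rel A ħ η c)

instance : Ring (Alg A ħ η c) := inferInstanceAs (Ring (RingQuot (Rel A ħ η c)))

instance : Algebra DeltaRing (Alg A ħ η c) :=
  inferInstanceAs (Algebra DeltaRing (RingQuot (Rel A ħ η c)))

/-- The generators as elements of the current algebra. -/
def gen (g : Gen ι) : Alg A ħ η c :=
  RingQuot.mkAlgHom DeltaRing (Rel A ħ η c) (fgen g)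

/-- The comultiplication on generators, with values in
`A_{ħ,η₁}(ĝ)_{c₁} ⊗ A_{ħ,η₂}(ĝ)_{c₂}`. -/
def comul (η₁ c₁ η₂ c₂ : ℝ) : Gen ι → Alg A ħ η₁ c₁ ⊗[DeltaRing] Alg A ħ η₂ c₂
  | .c => gen A ħ η₁ c₁ .c ⊗ₜ 1 + 1 ⊗ₜ gen A ħ η₂ c₂ .c
  | .H ε i u =>
      gen A ħ η₁ c₁ (.H ε i (u + sgn ε * (I * ħ * c₂ / 4))) ⊗ₜ
        gen A ħ η₂ c₂ (.H ε i (u - sgn ε * (I * ħ * c₁ / 4)))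
  | .E i u =>
      gen A ħ η₁ c₁ (.E i u) ⊗ₜ 1 +
        gen A ħ η₁ c₁ (.H (-1) i (u + I * ħ * c₁ / 4)) ⊗ₜ
          gen A ħ η₂ c₂ (.E i (u + I * ħ * c₁ / 2))
  | .F i u =>
      1 ⊗ₜ gen A ħ η₂ c₂ (.F i u) +
        gen A ħ η₁ c₁ (.F i (u + I * ħ * c₂ / 2)) ⊗ₜ
          gen A ħ η₂ c₂ (.H 1 i (u + I * ħ * c₂ / 4))

/-- `Δ_n^+` on generators, with values in
`A_{ħ,η^(n)}(ĝ)_{c_n} ⊗ A_{ħ,η^(n+1)}(ĝ)_{c_{n+1}}`. -/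
def comulPlus (η c : ℤ → ℝ) (n : ℤ) :
    Gen ι → Alg A ħ (η n) (c n) ⊗[DeltaRing] Alg A ħ (η (n + 1)) (c (n + 1)) :=
  comul A ħ (η n) (c n) (η (n + 1)) (c (n + 1))

/-- `Δ_n^-` on generators, with values in
`A_{ħ,η^(n-1)}(ĝ)_{c_{n-1}} ⊗ A_{ħ,η^(n)}(ĝ)_{c_n}`. -/
def comulMinus (η c : ℤ → ℝ) (n : ℤ) :
    Gen ι → Alg A ħ (η (n - 1)) (c (n - 1)) ⊗[DeltaRing] Alg A ħ (η n) (c n) :=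
  comul A ħ (η (n - 1)) (c (n - 1)) (η n) (c n)

end Relations

end CurrentAlgebra

end

/-!
The heart of the matter is that all the exchange relations `X Y = f(u - v) Y X` can be handled
uniformly through the predicate `ExchangeRel X Y f`, in which `f` is the germ at `0` of the
structure function expanded about `u - v`. This predicate is additive in `X` and in `Y`, it passes
to `Y`, `X` with the germ `1 / f(-t)` (`ExchangeRel.symm`), and it is multiplicative under tensor
products (`ExchangeRel.tmul`). The last point survives the cancellation of a zero of one structure
function against a pole of the other: in that case one of the two tensor factors vanishes on each
side of the relation. All structure functions are products of quotients of shifted hyperbolic sines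
(`shRatio`). With the three parameters `η₁`, `η₂ = η₁'`, `η₃ = η₂'`, the shifts of the spectral
parameters in the comultiplication are such that the quotients belonging to the intermediate
parameter `η₂` cancel, and those belonging to `η₁` and `η₃` are the structure functions at level
`c₁ + c₂`.

In `[ΔE_i(u), ΔF_j(v)]` the term in which both currents carry a Cartan current vanishes, by the same
cancellation (`HE_FH_comm`). Of the four delta functions coming from the two remaining commutators,
two have the same support and cancel there, and the other two give the required right-hand side
(`comul_EF`).

The Serre-like relations, imposed away from the zeros and poles of the structure functions, are a
consequence of the exchange relations (`serre_eq_zero`): all six orderings of the three currents are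
then scalar multiples of one of them, and the scalars add up to zero by a trigonometric identity
(`sinh_serre_identity`). So they hold for the comultiplied currents because these satisfy the right
exchange relations. The central element acts on the tensor product as the scalar `c₁ + c₂`.
-/

namespace CurrentAlgebra

/-! ### Exchange relations governed by a meromorphic germ -/

/-- The elements `X`, `Y` satisfy the exchange relation `X Y = f Y X`, where the value of `f` is
taken at `0`, as a limit: at a zero of `f` this says `X Y = 0`, and at a pole of `f` it is read as
`Y X = 0`. The germ `f` at `0` is required to be meromorphic and not identically zero. -/
structure ExchangeRel {S : Type*} [Ring S] [Algebra DeltaRing S] (X Y : S) (f : ℂ → ℂ) :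
    Prop where
  meromorphicAt : MeromorphicAt f 0
  ne_zero : ∀ᶠ t in 𝓝[≠] 0, f t ≠ 0
  mul_eq : ∀ l, Tendsto f (𝓝[≠] 0) (𝓝 l) → X * Y = (Polynomial.C l : DeltaRing) • (Y * X)
  mul_eq_zero : Tendsto f (𝓝[≠] 0) (Bornology.cobounded ℂ) → Y * X = 0

namespace ExchangeRel

variable {S : Type*} [Ring S] [Algebra DeltaRing S] {X X' Y Y' : S} {f g : ℂ → ℂ}

theorem congr (h : ExchangeRel X Y f) (hfg : f =ᶠ[𝓝[≠] 0] g) : ExchangeRel X Y g where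
  meromorphicAt := h.meromorphicAt.congr hfg
  ne_zero := by
    filter_upwards [hfg, h.ne_zero] with t h₁ h₂
    rwa [← h₁]
  mul_eq l hl := h.mul_eq l (hl.congr' hfg.symm)
  mul_eq_zero hl := h.mul_eq_zero (hl.congr' hfg.symm)

theorem add_left (h : ExchangeRel X Y f) (h' : ExchangeRel X' Y f) :
    ExchangeRel (X + X') Y f where
  meromorphicAt := h.meromorphicAt
  ne_zero := h.ne_zero
  mul_eq l hl := by rw [add_mul, mul_add, smul_add, h.mul_eq l hl, h'.mul_eq l hl]
  mul_eq_zero hl := by rw [mul_add, h.mul_eq_zero hl, h'.mul_eq_zero hl, add_zero]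

theorem add_right (h : ExchangeRel X Y f) (h' : ExchangeRel X Y' f) :
    ExchangeRel X (Y + Y') f where
  meromorphicAt := h.meromorphicAt
  ne_zero := h.ne_zero
  mul_eq l hl := by rw [add_mul, mul_add, smul_add, h.mul_eq l hl, h'.mul_eq l hl]
  mul_eq_zero hl := by rw [add_mul, h.mul_eq_zero hl, h'.mul_eq_zero hl, add_zero]

theorem of_commute (h : Commute X Y) : ExchangeRel X Y 1 where
  meromorphicAt := MeromorphicAt.const 1 0
  ne_zero := by simp
  mul_eq l hl := by
    have h1 : Tendsto (1 : ℂ → ℂ) (𝓝[≠] 0) (𝓝 1) := tendsto_const_nhds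
    rw [← tendsto_nhds_unique h1 hl, map_one, one_smul, h.eq]
  mul_eq_zero hl :=
    (not_tendsto_atTop_of_tendsto_nhds (tendsto_const_nhds (x := (1 : ℂ))).norm
      (tendsto_norm_atTop_iff_cobounded.2 hl)).elim

/-- If the structure function cancels to `1`, the two elements commute. -/
theorem commute (h : ExchangeRel X Y f) (hf : f =ᶠ[𝓝[≠] 0] 1) : X * Y = Y * X := by
  have := h.mul_eq 1 (tendsto_const_nhds.congr' hf.symm)
  rwa [map_one, one_smul] at this

/-- Exchanging the two factors replaces `f(x)` by `1 / f(-x)`. -/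
theorem symm (h : ExchangeRel X Y f) : ExchangeRel Y X (fun t => (f (-t))⁻¹) := by
  have hneg : Tendsto (fun t : ℂ => -t) (𝓝[≠] 0) (𝓝[≠] 0) := by
    have := ((Homeomorph.neg ℂ).map_punctured_nhds_eq 0).le
    rwa [Homeomorph.coe_neg, neg_zero] at this
  have hflip {F : Filter ℂ} (hl : Tendsto (fun t => (f (-t))⁻¹) (𝓝[≠] 0) F) :
      Tendsto (fun t => (f t)⁻¹) (𝓝[≠] 0) F := by
    simpa [Function.comp_def] using hl.comp hneg
  refine ⟨?_, ?_, fun l hl => ?_, fun hl => ?_⟩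
  · have hf : MeromorphicAt f (-0 : ℂ) := by simpa using h.meromorphicAt
    exact (hf.comp_analyticAt (g := fun t : ℂ => -t) (x := 0) (by fun_prop)).inv
  · filter_upwards [hneg.eventually h.ne_zero] with t ht
    exact inv_ne_zero ht
  · replace hl := hflip hl
    by_cases hl0 : l = 0
    · subst hl0
      have : Tendsto f (𝓝[≠] 0) (Bornology.cobounded ℂ) := by
        have h0 : Tendsto (fun t => (f t)⁻¹) (𝓝[≠] 0) (𝓝[≠] 0) :=
          tendsto_nhdsWithin_iff.2 ⟨hl, h.ne_zero.mono fun t ht => inv_ne_zero ht⟩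
        simpa [Function.comp_def] using tendsto_inv₀_nhdsNE_zero.comp h0
      rw [h.mul_eq_zero this, map_zero, zero_smul]
    · have := h.mul_eq l⁻¹ (by simpa using hl.inv₀ hl0)
      rw [this, smul_smul, ← map_mul, mul_inv_cancel₀ hl0, map_one, one_smul]
  · have : Tendsto f (𝓝[≠] 0) (𝓝 0) := by
      simpa [Function.comp_def] using tendsto_inv₀_cobounded.comp (hflip hl)
    rw [h.mul_eq 0 this, map_zero, zero_smul]

/-- Structure functions multiply under tensor products. A zero of one of them may cancel a pole of
the other; then both sides of the relation vanish. -/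
theorem tmul {T : Type*} [Ring T] [Algebra DeltaRing T] {Z W : T}
    (h : ExchangeRel X Y f) (h' : ExchangeRel Z W g) :
    ExchangeRel (X ⊗ₜ[DeltaRing] Z) (Y ⊗ₜ[DeltaRing] W) (f * g) := by
  have hf := h.meromorphicAt
  have hg := h'.meromorphicAt
  refine ⟨hf.mul hg, ?_, fun l hl => ?_, fun hl => ?_⟩
  · filter_upwards [h.ne_zero, h'.ne_zero] with t h₁ h₂
    exact mul_ne_zero h₁ h₂
  · have ho : 0 ≤ meromorphicOrderAt f 0 + meromorphicOrderAt g 0 := by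
      rw [← meromorphicOrderAt_mul hf hg]
      exact (tendsto_nhds_iff_meromorphicOrderAt_nonneg (hf.mul hg)).1 ⟨l, hl⟩
    rw [Algebra.TensorProduct.tmul_mul_tmul, Algebra.TensorProduct.tmul_mul_tmul]
    rcases lt_or_ge (meromorphicOrderAt f 0) 0 with hof | hof
    · have hog : 0 < meromorphicOrderAt g 0 :=
        not_le.1 fun hg => absurd ho (not_le.2 ((add_le_of_nonpos_right hg).trans_lt hof))
      rw [h.mul_eq_zero (tendsto_cobounded_of_meromorphicOrderAt_neg hof),
        h'.mul_eq 0 (tendsto_zero_of_meromorphicOrderAt_pos hog)]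
      simp
    rcases lt_or_ge (meromorphicOrderAt g 0) 0 with hog | hog
    · have hof : 0 < meromorphicOrderAt f 0 :=
        not_le.1 fun hf => absurd ho (not_le.2 ((add_le_of_nonpos_left hf).trans_lt hog))
      rw [h'.mul_eq_zero (tendsto_cobounded_of_meromorphicOrderAt_neg hog),
        h.mul_eq 0 (tendsto_zero_of_meromorphicOrderAt_pos hof)]
      simp
    obtain ⟨a, ha⟩ := tendsto_nhds_of_meromorphicOrderAt_nonneg hf hof
    obtain ⟨b, hb⟩ := tendsto_nhds_of_meromorphicOrderAt_nonneg hg hog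
    rw [tendsto_nhds_unique hl (ha.mul hb), h.mul_eq a ha, h'.mul_eq b hb,
      TensorProduct.smul_tmul_smul, map_mul]
  · have ho : meromorphicOrderAt f 0 + meromorphicOrderAt g 0 < 0 := by
      rw [← meromorphicOrderAt_mul hf hg]
      exact (tendsto_cobounded_iff_meromorphicOrderAt_neg (hf.mul hg)).1 hl
    rw [Algebra.TensorProduct.tmul_mul_tmul]
    rcases lt_or_ge (meromorphicOrderAt f 0) 0 with hof | hof
    · rw [h.mul_eq_zero (tendsto_cobounded_of_meromorphicOrderAt_neg hof),
        TensorProduct.zero_tmul]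
    · have hog : meromorphicOrderAt g 0 < 0 :=
        not_le.1 fun hg => absurd ho (not_lt.2 (add_nonneg hof hg))
      rw [h'.mul_eq_zero (tendsto_cobounded_of_meromorphicOrderAt_neg hog),
        TensorProduct.tmul_zero]

end ExchangeRel

/-! ### Quotients of shifted hyperbolic sines -/

theorem sh_neg (η : ℝ) (z : ℂ) : sh η (-z) = -sh η z := by
  simp [sh]

theorem analyticAt_sh_add (η : ℝ) (p t : ℂ) : AnalyticAt ℂ (fun t => sh η (t + p)) t := by
  unfold sh
  fun_prop

theorem eventually_sh_add_ne_zero {η : ℝ} (hη : η ≠ 0) (p : ℂ) :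
    ∀ᶠ t in 𝓝[≠] (0 : ℂ), sh η (t + p) ≠ 0 := by
  rcases (analyticAt_sh_add η p 0).eventually_eq_zero_or_eventually_ne_zero with h | h
  · exfalso
    -- The derivative of `sh πη(t + p)` is `πη ch πη(t + p)`, and `ch² - sh² = 1`.
    have hd : HasDerivAt (fun t => sh η (t + p))
        (Complex.cosh (Real.pi * η * (0 + p)) * (Real.pi * η)) 0 := by
      have : HasDerivAt (fun t : ℂ => Real.pi * η * (t + p)) (Real.pi * η) 0 := by
        simpa using ((hasDerivAt_id (0 : ℂ)).add_const p).const_mul (Real.pi * η : ℂ)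
      exact this.csinh
    have h0 := hd.unique ((hasDerivAt_const (0 : ℂ) (0 : ℂ)).congr_of_eventuallyEq h)
    have h1 : Complex.sinh (Real.pi * η * (0 + p)) = 0 := h.self_of_nhds
    have h2 := Complex.cosh_sq_sub_sinh_sq (Real.pi * η * (0 + p))
    have h3 : Complex.cosh (Real.pi * η * (0 + p)) = 0 := by
      simpa [hη, Real.pi_ne_zero] using h0
    rw [h1, h3] at h2
    simp at h2
  · exact h

/-- The germ `t ↦ sh πη(t + p) / sh πη(t + q)`. Every structure function of the current algebra,
expanded about the point `u - v`, is a product of one or two of these. -/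
noncomputable def shRatio (η : ℝ) (p q : ℂ) : ℂ → ℂ := fun t => sh η (t + p) / sh η (t + q)

theorem meromorphicAt_shRatio (η : ℝ) (p q : ℂ) : MeromorphicAt (shRatio η p q) 0 :=
  (analyticAt_sh_add η p 0).meromorphicAt.div (analyticAt_sh_add η q 0).meromorphicAt

theorem eventually_shRatio_ne_zero {η : ℝ} (hη : η ≠ 0) (p q : ℂ) :
    ∀ᶠ t in 𝓝[≠] 0, shRatio η p q t ≠ 0 := by
  filter_upwards [eventually_sh_add_ne_zero hη p, eventually_sh_add_ne_zero hη q] with t h₁ h₂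
  exact div_ne_zero h₁ h₂

theorem shRatio_neg_inv (η : ℝ) (p q t : ℂ) :
    (shRatio η p q (-t))⁻¹ = shRatio η (-q) (-p) t := by
  rw [shRatio, shRatio, inv_div, show -t + q = -(t + -q) by ring,
    show -t + p = -(t + -p) by ring, sh_neg, sh_neg, neg_div_neg_eq]

theorem shRatio_mul_swap {η : ℝ} (hη : η ≠ 0) (p q : ℂ) :
    shRatio η p q * shRatio η q p =ᶠ[𝓝[≠] 0] 1 := by
  filter_upwards [eventually_sh_add_ne_zero hη p, eventually_sh_add_ne_zero hη q] with t h₁ h₂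
  simp only [Pi.mul_apply, shRatio, Pi.one_apply]
  field_simp

theorem tendsto_shRatio (η : ℝ) (p : ℂ) {q : ℂ} (hq : sh η q ≠ 0) :
    Tendsto (shRatio η p q) (𝓝[≠] 0) (𝓝 (sh η p / sh η q)) := by
  have hc (p : ℂ) : Tendsto (fun t => sh η (t + p)) (𝓝[≠] 0) (𝓝 (sh η p)) := by
    simpa using (analyticAt_sh_add η p 0).continuousAt.tendsto.mono_left
      (nhdsWithin_le_nhds (s := {0}ᶜ))
  exact (hc p).div (hc q) hq

/-! ### The exchange relations of the current algebra -/

/-- Passage between a structure function at the point `x` and its translate to `0`. -/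
theorem tendsto_nhdsNE_zero_iff {f g : ℂ → ℂ} {x : ℂ} (hfg : ∀ t, f (x + t) = g t)
    (F : Filter ℂ) : Tendsto g (𝓝[≠] 0) F ↔ Tendsto f (𝓝[≠] x) F := by
  have := (Homeomorph.addLeft x).map_punctured_nhds_eq 0
  simp only [Homeomorph.coe_addLeft, add_zero] at this
  rw [← this, tendsto_map'_iff]
  exact tendsto_congr fun t => (hfg t).symm

section Generators

variable {ι : Type*} [DecidableEq ι] (A : Matrix ι ι ℤ) (ħ : ℝ) {η : ℝ} (c : ℝ) {η' : ℝ}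

theorem exchangeRel_gen {X Y : Gen ι} {f g : ℂ → ℂ} {x : ℂ} (hf : Exch A ħ η c X Y f x)
    (hfg : ∀ t, f (x + t) = g t) (hmer : MeromorphicAt g 0)
    (hne : ∀ᶠ t in 𝓝[≠] 0, g t ≠ 0) : ExchangeRel (gen A ħ η c X) (gen A ħ η c Y) g := by
  refine ⟨hmer, hne, fun l hl => ?_, fun hl => ?_⟩ <;>
    replace hl := (tendsto_nhdsNE_zero_iff hfg _).1 hl
  · have := RingQuot.mkAlgHom_rel DeltaRing (Rel.exchange hf hl)
    rw [map_mul, map_smul, map_mul] at this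
    exact this
  · have := RingQuot.mkAlgHom_rel DeltaRing (Rel.exchange_pole hf hl)
    rw [map_mul, map_zero] at this
    exact this

theorem exchangeRel_gen_shRatio {X Y : Gen ι} {f : ℂ → ℂ} {x : ℂ} (hf : Exch A ħ η c X Y f x)
    {κ : ℝ} (hκ : κ ≠ 0) {p q : ℂ} (hfg : ∀ t, f (x + t) = shRatio κ p q t) :
    ExchangeRel (gen A ħ η c X) (gen A ħ η c Y) (shRatio κ p q) :=
  exchangeRel_gen A ħ c hf hfg (meromorphicAt_shRatio κ p q) (eventually_shRatio_ne_zero hκ p q)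

theorem exchangeRel_gen_shRatio_mul {X Y : Gen ι} {f : ℂ → ℂ} {x : ℂ}
    (hf : Exch A ħ η c X Y f x) {κ : ℝ} (hη : η ≠ 0) (hκ : κ ≠ 0) {p q r s : ℂ}
    (hfg : ∀ t, f (x + t) = shRatio η p q t * shRatio κ r s t) :
    ExchangeRel (gen A ħ η c X) (gen A ħ η c Y) (shRatio η p q * shRatio κ r s) := by
  refine exchangeRel_gen A ħ c hf hfg
    ((meromorphicAt_shRatio η p q).mul (meromorphicAt_shRatio κ r s)) ?_
  filter_upwards [eventually_shRatio_ne_zero hη p q, eventually_shRatio_ne_zero hκ r s]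
    with t h₁ h₂
  exact mul_ne_zero h₁ h₂

theorem exchangeRel_gen_HpHm (hη : η ≠ 0) (hη' : η' ≠ 0) (h : etaPrime ħ η c = η') (i j : ι)
    {u v p q r s : ℂ} (hp : p = u - v - Complex.I * ħ * (B A i j - c / 2))
    (hq : q = u - v + Complex.I * ħ * (B A i j + c / 2))
    (hr : r = u - v + Complex.I * ħ * (B A i j - c / 2))
    (hs : s = u - v - Complex.I * ħ * (B A i j + c / 2)) :
    ExchangeRel (gen A ħ η c (.H 1 i u)) (gen A ħ η c (.H (-1) j v))
      (shRatio η p q * shRatio η' r s) := by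
  subst h hp hq hr hs
  refine exchangeRel_gen_shRatio_mul A ħ c (.HpHm i j u v) hη hη' fun t => ?_
  simp only [shRatio]
  ring_nf

theorem exchangeRel_gen_HH (hη : η ≠ 0) (hη' : η' ≠ 0) (h : etaPrime ħ η c = η') (ε : ℤˣ)
    (i j : ι) {u v p q : ℂ} (hp : p = u - v - Complex.I * ħ * B A i j)
    (hq : q = u - v + Complex.I * ħ * B A i j) :
    ExchangeRel (gen A ħ η c (.H ε i u)) (gen A ħ η c (.H ε j v))
      (shRatio η p q * shRatio η' q p) := by
  subst h hp hq
  refine exchangeRel_gen_shRatio_mul A ħ c (.HH ε i j u v) hη hη' fun t => ?_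
  simp only [shRatio]
  ring_nf

theorem exchangeRel_gen_HE (hη : η ≠ 0) (ε : ℤˣ) (i j : ι) {u v p q : ℂ}
    (hp : p = u - v - Complex.I * ħ * (B A i j - sgn ε * c / 4))
    (hq : q = u - v + Complex.I * ħ * (B A i j + sgn ε * c / 4)) :
    ExchangeRel (gen A ħ η c (.H ε i u)) (gen A ħ η c (.E j v)) (shRatio η p q) := by
  subst hp hq
  refine exchangeRel_gen_shRatio A ħ c (.HE ε i j u v) hη fun t => ?_
  simp only [shRatio]
  ring_nf

theorem exchangeRel_gen_HF (hη' : η' ≠ 0) (h : etaPrime ħ η c = η') (ε : ℤˣ) (i j : ι)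
    {u v p q : ℂ} (hp : p = u - v + Complex.I * ħ * (B A i j - sgn ε * c / 4))
    (hq : q = u - v - Complex.I * ħ * (B A i j + sgn ε * c / 4)) :
    ExchangeRel (gen A ħ η c (.H ε i u)) (gen A ħ η c (.F j v)) (shRatio η' p q) := by
  subst h hp hq
  refine exchangeRel_gen_shRatio A ħ c (.HF ε i j u v) hη' fun t => ?_
  simp only [shRatio]
  ring_nf

theorem exchangeRel_gen_EE (hη : η ≠ 0) (i j : ι) {u v p q : ℂ}
    (hp : p = u - v - Complex.I * ħ * B A i j) (hq : q = u - v + Complex.I * ħ * B A i j) :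
    ExchangeRel (gen A ħ η c (.E i u)) (gen A ħ η c (.E j v)) (shRatio η p q) := by
  subst hp hq
  refine exchangeRel_gen_shRatio A ħ c (.EE i j u v) hη fun t => ?_
  simp only [shRatio]
  ring_nf

theorem exchangeRel_gen_FF (hη' : η' ≠ 0) (h : etaPrime ħ η c = η') (i j : ι) {u v p q : ℂ}
    (hp : p = u - v + Complex.I * ħ * B A i j) (hq : q = u - v - Complex.I * ħ * B A i j) :
    ExchangeRel (gen A ħ η c (.F i u)) (gen A ħ η c (.F j v)) (shRatio η' p q) := by
  subst h hp hq
  refine exchangeRel_gen_shRatio A ħ c (.FF i j u v) hη' fun t => ?_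
  simp only [shRatio]
  ring_nf

theorem gen_EF (i j : ι) (u v : ℂ) :
    gen A ħ η c (.E i u) * gen A ħ η c (.F j v) - gen A ħ η c (.F j v) * gen A ħ η c (.E i u) =
      if i = j then
        (Polynomial.C (2 * Real.pi / ħ : ℂ) : DeltaRing) •
          (delta (u - v - Complex.I * ħ * c / 2) • gen A ħ η c (.H 1 i (u - Complex.I * ħ * c / 4))
            - delta (u - v + Complex.I * ħ * c / 2) •
              gen A ħ η c (.H (-1) i (v - Complex.I * ħ * c / 4)))
      else 0 := by
  have := RingQuot.mkAlgHom_rel DeltaRing (Rel.EF (A := A) (ħ := ħ) (η := η) (c := c) i j u v)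
  split_ifs at this ⊢ with hij <;>
  · simp only [map_sub, map_mul, map_smul, map_zero] at this
    exact this

theorem gen_c : gen A ħ η c .c = algebraMap DeltaRing _ (Polynomial.C (c : ℂ)) := by
  have := RingQuot.mkAlgHom_rel DeltaRing (Rel.level (A := A) (ħ := ħ) (η := η) (c := c))
  rw [AlgHom.commutes] at this
  exact this

end Generators

/-! ### The exchange relations of the comultiplied currents -/

namespace ExchangeRel

variable {S T : Type*} [Ring S] [Algebra DeltaRing S] [Ring T] [Algebra DeltaRing T]
  {X Y : S} {Z W : T} {κ μ ν : ℝ} {p q r s a b : ℂ}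

theorem shRatio_symm (h : ExchangeRel X Y (shRatio κ (-q) (-p))) :
    ExchangeRel Y X (shRatio κ p q) :=
  h.symm.congr (.of_forall fun t => by
    simpa using shRatio_neg_inv κ (-q) (-p) t)

theorem shRatio_mul_symm (h : ExchangeRel X Y (shRatio κ (-q) (-p) * shRatio μ (-s) (-r))) :
    ExchangeRel Y X (shRatio κ p q * shRatio μ r s) := by
  refine h.symm.congr (.of_forall fun t => ?_)
  simp only [Pi.mul_apply, mul_inv, shRatio_neg_inv, neg_neg]

theorem tmul_commute {f : ℂ → ℂ} (h : ExchangeRel X Y f) (h' : Commute Z W) :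
    ExchangeRel (X ⊗ₜ[DeltaRing] Z) (Y ⊗ₜ[DeltaRing] W) f := by
  simpa using h.tmul (of_commute h')

theorem commute_tmul {f : ℂ → ℂ} (h : Commute X Y) (h' : ExchangeRel Z W f) :
    ExchangeRel (X ⊗ₜ[DeltaRing] Z) (Y ⊗ₜ[DeltaRing] W) f := by
  simpa using (of_commute h).tmul h'

/-- The structure functions of the factors with the intermediate parameter `μ` cancel. -/
theorem tmul_cancel (hμ : μ ≠ 0) (h : ExchangeRel X Y (shRatio κ p q * shRatio μ r s))
    (h' : ExchangeRel Z W (shRatio μ s r * shRatio ν a b)) :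
    ExchangeRel (X ⊗ₜ[DeltaRing] Z) (Y ⊗ₜ[DeltaRing] W) (shRatio κ p q * shRatio ν a b) := by
  refine (h.tmul h').congr ?_
  filter_upwards [shRatio_mul_swap hμ r s] with t ht
  simp only [Pi.mul_apply, Pi.one_apply] at ht ⊢
  linear_combination (shRatio κ p q t * shRatio ν a b t) * ht

theorem tmul_cancel_right (hμ : μ ≠ 0) (h : ExchangeRel X Y (shRatio κ p q * shRatio μ r s))
    (h' : ExchangeRel Z W (shRatio μ s r)) :
    ExchangeRel (X ⊗ₜ[DeltaRing] Z) (Y ⊗ₜ[DeltaRing] W) (shRatio κ p q) := by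
  refine (h.tmul h').congr ?_
  filter_upwards [shRatio_mul_swap hμ r s] with t ht
  simp only [Pi.mul_apply, Pi.one_apply] at ht ⊢
  linear_combination shRatio κ p q t * ht

theorem tmul_cancel_left (hμ : μ ≠ 0) (h : ExchangeRel X Y (shRatio μ r s))
    (h' : ExchangeRel Z W (shRatio μ s r * shRatio ν a b)) :
    ExchangeRel (X ⊗ₜ[DeltaRing] Z) (Y ⊗ₜ[DeltaRing] W) (shRatio ν a b) := by
  refine (h.tmul h').congr ?_
  filter_upwards [shRatio_mul_swap hμ r s] with t ht
  simp only [Pi.mul_apply, Pi.one_apply] at ht ⊢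
  linear_combination shRatio ν a b t * ht

end ExchangeRel

theorem B_symm {ι : Type*} {A : Matrix ι ι ℤ} (hA : A.IsSymm) (i j : ι) : B A j i = B A i j := by
  rw [B, B, hA.apply]

theorem B_self {ι : Type*} {A : Matrix ι ι ℤ} {i : ι} (h : A i i = 2) : B A i i = 1 := by
  simp [B, h]

theorem B_of_neg_one {ι : Type*} {A : Matrix ι ι ℤ} {i j : ι} (h : A i j = -1) : B A i j = -1 / 2 := by
  simp [B, h]

theorem sgn_one : sgn 1 = 1 := by simp [sgn]

theorem sgn_neg_one : sgn (-1) = -1 := by simp [sgn]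

section Comul

variable {ι : Type*} [DecidableEq ι] (A : Matrix ι ι ℤ) (ħ : ℝ) {η₁ η₂ η₃ : ℝ} (c₁ c₂ : ℝ)

theorem exchangeRel_comul_HpHm (h₁ : η₁ ≠ 0) (h₂ : η₂ ≠ 0) (h₃ : η₃ ≠ 0)
    (h₁₂ : etaPrime ħ η₁ c₁ = η₂) (h₂₃ : etaPrime ħ η₂ c₂ = η₃) (i j : ι) (u v : ℂ) :
    ExchangeRel (comul A ħ η₁ c₁ η₂ c₂ (.H 1 i u)) (comul A ħ η₁ c₁ η₂ c₂ (.H (-1) j v))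
      (shRatio η₁ (u - v - Complex.I * ħ * (B A i j - (c₁ + c₂ : ℝ) / 2))
          (u - v + Complex.I * ħ * (B A i j + (c₁ + c₂ : ℝ) / 2)) *
        shRatio η₃ (u - v + Complex.I * ħ * (B A i j - (c₁ + c₂ : ℝ) / 2))
          (u - v - Complex.I * ħ * (B A i j + (c₁ + c₂ : ℝ) / 2))) := by
  simp only [comul, sgn_one, sgn_neg_one]
  push_cast
  exact .tmul_cancel h₂
    (exchangeRel_gen_HpHm A ħ c₁ h₁ h₂ h₁₂ i j (by ring) (by ring) rfl rfl)
    (exchangeRel_gen_HpHm A ħ c₂ h₂ h₃ h₂₃ i j (by ring) (by ring) (by ring) (by ring))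

theorem exchangeRel_comul_HH (h₁ : η₁ ≠ 0) (h₂ : η₂ ≠ 0) (h₃ : η₃ ≠ 0)
    (h₁₂ : etaPrime ħ η₁ c₁ = η₂) (h₂₃ : etaPrime ħ η₂ c₂ = η₃) (ε : ℤˣ) (i j : ι) (u v : ℂ) :
    ExchangeRel (comul A ħ η₁ c₁ η₂ c₂ (.H ε i u)) (comul A ħ η₁ c₁ η₂ c₂ (.H ε j v))
      (shRatio η₁ (u - v - Complex.I * ħ * B A i j) (u - v + Complex.I * ħ * B A i j) *
        shRatio η₃ (u - v + Complex.I * ħ * B A i j) (u - v - Complex.I * ħ * B A i j)) := by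
  simp only [comul]
  exact .tmul_cancel h₂
    (exchangeRel_gen_HH A ħ c₁ h₁ h₂ h₁₂ ε i j (by ring) (by ring))
    (exchangeRel_gen_HH A ħ c₂ h₂ h₃ h₂₃ ε i j (by ring) (by ring))

theorem exchangeRel_comul_HE (h₁ : η₁ ≠ 0) (h₂ : η₂ ≠ 0)
    (h₁₂ : etaPrime ħ η₁ c₁ = η₂) (ε : ℤˣ) (i j : ι) (u v : ℂ) :
    ExchangeRel (comul A ħ η₁ c₁ η₂ c₂ (.H ε i u)) (comul A ħ η₁ c₁ η₂ c₂ (.E j v))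
      (shRatio η₁ (u - v - Complex.I * ħ * (B A i j - sgn ε * (c₁ + c₂ : ℝ) / 4))
        (u - v + Complex.I * ħ * (B A i j + sgn ε * (c₁ + c₂ : ℝ) / 4))) := by
  simp only [comul]
  push_cast
  refine .add_right (.tmul_commute
    (exchangeRel_gen_HE A ħ c₁ h₁ ε i j (by ring) (by ring)) (.one_right _)) ?_
  obtain rfl | rfl := Int.units_eq_one_or ε
  · simp only [sgn_one]
    exact .tmul_cancel_right h₂
      (exchangeRel_gen_HpHm A ħ c₁ h₁ h₂ h₁₂ i j (by ring) (by ring) rfl rfl)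
      (exchangeRel_gen_HE A ħ c₂ h₂ 1 i j (by rw [sgn_one]; ring) (by rw [sgn_one]; ring))
  · simp only [sgn_neg_one]
    exact .tmul_cancel_right h₂
      (exchangeRel_gen_HH A ħ c₁ h₁ h₂ h₁₂ (-1) i j (by ring) (by ring))
      (exchangeRel_gen_HE A ħ c₂ h₂ (-1) i j (by rw [sgn_neg_one]; ring)
        (by rw [sgn_neg_one]; ring))

theorem exchangeRel_comul_HF (hA : A.IsSymm) (h₂ : η₂ ≠ 0) (h₃ : η₃ ≠ 0)
    (h₁₂ : etaPrime ħ η₁ c₁ = η₂) (h₂₃ : etaPrime ħ η₂ c₂ = η₃) (ε : ℤˣ) (i j : ι) (u v : ℂ) :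
    ExchangeRel (comul A ħ η₁ c₁ η₂ c₂ (.H ε i u)) (comul A ħ η₁ c₁ η₂ c₂ (.F j v))
      (shRatio η₃ (u - v + Complex.I * ħ * (B A i j - sgn ε * (c₁ + c₂ : ℝ) / 4))
        (u - v - Complex.I * ħ * (B A i j + sgn ε * (c₁ + c₂ : ℝ) / 4))) := by
  simp only [comul]
  push_cast
  refine .add_right (.commute_tmul (.one_right _)
    (exchangeRel_gen_HF A ħ c₂ h₃ h₂₃ ε i j (by ring) (by ring))) ?_
  obtain rfl | rfl := Int.units_eq_one_or ε
  · simp only [sgn_one]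
    exact .tmul_cancel_left h₂
      (exchangeRel_gen_HF A ħ c₁ h₂ h₁₂ 1 i j (by rw [sgn_one]; ring) (by rw [sgn_one]; ring))
      (exchangeRel_gen_HH A ħ c₂ h₂ h₃ h₂₃ 1 i j (by ring) (by ring))
  · simp only [sgn_neg_one]
    exact .tmul_cancel_left h₂
      (exchangeRel_gen_HF A ħ c₁ h₂ h₁₂ (-1) i j rfl rfl)
      (.shRatio_mul_symm (exchangeRel_gen_HpHm A ħ c₂ h₂ h₃ h₂₃ j i
        (by rw [sgn_neg_one, B_symm hA]; ring) (by rw [sgn_neg_one, B_symm hA]; ring)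
        (by rw [B_symm hA]; ring) (by rw [B_symm hA]; ring)))

theorem exchangeRel_comul_EE (hA : A.IsSymm) (h₁ : η₁ ≠ 0) (h₂ : η₂ ≠ 0)
    (h₁₂ : etaPrime ħ η₁ c₁ = η₂) (i j : ι) {u v p q : ℂ}
    (hp : p = u - v - Complex.I * ħ * B A i j) (hq : q = u - v + Complex.I * ħ * B A i j) :
    ExchangeRel (comul A ħ η₁ c₁ η₂ c₂ (.E i u)) (comul A ħ η₁ c₁ η₂ c₂ (.E j v))
      (shRatio η₁ p q) := by
  subst hp hq
  simp only [comul]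
  refine .add_left (.add_right ?_ ?_) (.add_right ?_ ?_)
  · exact .tmul_commute (exchangeRel_gen_EE A ħ c₁ h₁ i j rfl rfl) (.one_right _)
  · exact .tmul_commute (.shRatio_symm (exchangeRel_gen_HE A ħ c₁ h₁ (-1) j i
      (by rw [sgn_neg_one, B_symm hA]; ring) (by rw [sgn_neg_one, B_symm hA]; ring))) (.one_left _)
  · exact .tmul_commute (exchangeRel_gen_HE A ħ c₁ h₁ (-1) i j
      (by rw [sgn_neg_one]; ring) (by rw [sgn_neg_one]; ring)) (.one_right _)
  · exact .tmul_cancel_right h₂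
      (exchangeRel_gen_HH A ħ c₁ h₁ h₂ h₁₂ (-1) i j (by ring) (by ring))
      (exchangeRel_gen_EE A ħ c₂ h₂ i j (by ring) (by ring))

theorem exchangeRel_comul_FF (hA : A.IsSymm) (h₂ : η₂ ≠ 0) (h₃ : η₃ ≠ 0)
    (h₁₂ : etaPrime ħ η₁ c₁ = η₂) (h₂₃ : etaPrime ħ η₂ c₂ = η₃) (i j : ι) {u v p q : ℂ}
    (hp : p = u - v + Complex.I * ħ * B A i j) (hq : q = u - v - Complex.I * ħ * B A i j) :
    ExchangeRel (comul A ħ η₁ c₁ η₂ c₂ (.F i u)) (comul A ħ η₁ c₁ η₂ c₂ (.F j v))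
      (shRatio η₃ p q) := by
  subst hp hq
  simp only [comul]
  refine .add_left (.add_right ?_ ?_) (.add_right ?_ ?_)
  · exact .commute_tmul (.one_right _) (exchangeRel_gen_FF A ħ c₂ h₃ h₂₃ i j rfl rfl)
  · exact .commute_tmul (.one_left _) (.shRatio_symm (exchangeRel_gen_HF A ħ c₂ h₃ h₂₃ 1 j i
      (by rw [sgn_one, B_symm hA]; ring) (by rw [sgn_one, B_symm hA]; ring)))
  · exact .commute_tmul (.one_right _) (exchangeRel_gen_HF A ħ c₂ h₃ h₂₃ 1 i j
      (by rw [sgn_one]; ring) (by rw [sgn_one]; ring))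
  · exact .tmul_cancel_left h₂
      (exchangeRel_gen_FF A ħ c₁ h₂ h₁₂ i j (by ring) (by ring))
      (exchangeRel_gen_HH A ħ c₂ h₂ h₃ h₂₃ 1 i j (by ring) (by ring))

/-! ### The commutator of `E` and `F` -/

theorem delta_smul_congr {M : Type*} [AddCommGroup M] [Module DeltaRing M] {z : ℂ} {m m' : M}
    (h : z = 0 → m = m') : delta z • m = delta z • m' := by
  by_cases hz : z = 0
  · rw [h hz]
  · simp [delta, hz]

/-- The term of `[ΔE, ΔF]` in which both currents are multiplied by a Cartan current vanishes:
the structure functions of `H⁻ F` in the first factor and of `E H⁺` in the second, both with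
parameter `η₂`, are inverse to each other. -/
theorem HE_FH_comm (hA : A.IsSymm) (h₂ : η₂ ≠ 0) (h₁₂ : etaPrime ħ η₁ c₁ = η₂) (i j : ι)
    (u v : ℂ) :
    gen A ħ η₁ c₁ (.H (-1) i (u + Complex.I * ħ * c₁ / 4)) ⊗ₜ[DeltaRing]
        gen A ħ η₂ c₂ (.E i (u + Complex.I * ħ * c₁ / 2)) *
      gen A ħ η₁ c₁ (.F j (v + Complex.I * ħ * c₂ / 2)) ⊗ₜ[DeltaRing]
        gen A ħ η₂ c₂ (.H 1 j (v + Complex.I * ħ * c₂ / 4)) =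
    gen A ħ η₁ c₁ (.F j (v + Complex.I * ħ * c₂ / 2)) ⊗ₜ[DeltaRing]
        gen A ħ η₂ c₂ (.H 1 j (v + Complex.I * ħ * c₂ / 4)) *
      gen A ħ η₁ c₁ (.H (-1) i (u + Complex.I * ħ * c₁ / 4)) ⊗ₜ[DeltaRing]
        gen A ħ η₂ c₂ (.E i (u + Complex.I * ħ * c₁ / 2)) := by
  have h := exchangeRel_gen_HF A ħ c₁ h₂ h₁₂ (-1) i j (u := u + Complex.I * ħ * c₁ / 4)
    (v := v + Complex.I * ħ * c₂ / 2) rfl rfl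
  refine (h.tmul (.shRatio_symm (exchangeRel_gen_HE A ħ c₂ h₂ 1 j i ?_ ?_))).commute
    (shRatio_mul_swap h₂ _ _) <;>
  · rw [sgn_neg_one, sgn_one, B_symm hA]
    ring

/-- In `[ΔE, ΔF]` only the commutators `[E, F] ⊗ H⁺` and `H⁻ ⊗ [E, F]` survive. Each contributes
two delta functions; those with support `u - v = iħ(c₂ - c₁)/2` cancel. -/
theorem comul_EF (hA : A.IsSymm) (h₂ : η₂ ≠ 0) (h₁₂ : etaPrime ħ η₁ c₁ = η₂) (i j : ι)
    (u v : ℂ) :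
    comul A ħ η₁ c₁ η₂ c₂ (.E i u) * comul A ħ η₁ c₁ η₂ c₂ (.F j v) -
        comul A ħ η₁ c₁ η₂ c₂ (.F j v) * comul A ħ η₁ c₁ η₂ c₂ (.E i u) =
      if i = j then
        (Polynomial.C (2 * Real.pi / ħ : ℂ) : DeltaRing) •
          (delta (u - v - Complex.I * ħ * (c₁ + c₂ : ℝ) / 2) •
              comul A ħ η₁ c₁ η₂ c₂ (.H 1 i (u - Complex.I * ħ * (c₁ + c₂ : ℝ) / 4))
            - delta (u - v + Complex.I * ħ * (c₁ + c₂ : ℝ) / 2) •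
              comul A ħ η₁ c₁ η₂ c₂ (.H (-1) i (v - Complex.I * ħ * (c₁ + c₂ : ℝ) / 4)))
      else 0 := by
  have key : comul A ħ η₁ c₁ η₂ c₂ (.E i u) * comul A ħ η₁ c₁ η₂ c₂ (.F j v) -
        comul A ħ η₁ c₁ η₂ c₂ (.F j v) * comul A ħ η₁ c₁ η₂ c₂ (.E i u) =
      (gen A ħ η₁ c₁ (.E i u) * gen A ħ η₁ c₁ (.F j (v + Complex.I * ħ * c₂ / 2)) -
          gen A ħ η₁ c₁ (.F j (v + Complex.I * ħ * c₂ / 2)) * gen A ħ η₁ c₁ (.E i u)) ⊗ₜ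
        gen A ħ η₂ c₂ (.H 1 j (v + Complex.I * ħ * c₂ / 4)) +
      gen A ħ η₁ c₁ (.H (-1) i (u + Complex.I * ħ * c₁ / 4)) ⊗ₜ
        (gen A ħ η₂ c₂ (.E i (u + Complex.I * ħ * c₁ / 2)) * gen A ħ η₂ c₂ (.F j v) -
          gen A ħ η₂ c₂ (.F j v) * gen A ħ η₂ c₂ (.E i (u + Complex.I * ħ * c₁ / 2))) := by
    have h := HE_FH_comm A ħ c₁ c₂ hA h₂ h₁₂ i j u v
    simp only [comul, mul_add, add_mul, h, TensorProduct.sub_tmul, TensorProduct.tmul_sub]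
    simp only [Algebra.TensorProduct.tmul_mul_tmul, one_mul, mul_one]
    abel
  rw [key, gen_EF, gen_EF]
  split_ifs with hij
  · subst hij
    simp only [comul, sgn_one, sgn_neg_one, ← TensorProduct.smul_tmul',
      TensorProduct.tmul_smul, ← smul_add, TensorProduct.sub_tmul, TensorProduct.tmul_sub]
    push_cast
    congr 1
    -- The two middle delta functions have the same support, where their coefficients agree.
    have hmid : u + Complex.I * ħ * c₁ / 2 - v - Complex.I * ħ * c₂ / 2 =
        u - (v + Complex.I * ħ * c₂ / 2) + Complex.I * ħ * c₁ / 2 := by ring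
    have hp : u - (v + Complex.I * ħ * c₂ / 2) - Complex.I * ħ * c₁ / 2 =
        u - v - Complex.I * ħ * (c₁ + c₂) / 2 := by ring
    have hm : u + Complex.I * ħ * c₁ / 2 - v + Complex.I * ħ * c₂ / 2 =
        u - v + Complex.I * ħ * (c₁ + c₂) / 2 := by ring
    have hcancel :
        delta (u - (v + Complex.I * ħ * c₂ / 2) + Complex.I * ħ * c₁ / 2) •
            gen A ħ η₁ c₁ (.H (-1) i (v + Complex.I * ħ * c₂ / 2 - Complex.I * ħ * c₁ / 4)) ⊗ₜ
              gen A ħ η₂ c₂ (.H 1 i (v + Complex.I * ħ * c₂ / 4)) =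
          delta (u - (v + Complex.I * ħ * c₂ / 2) + Complex.I * ħ * c₁ / 2) •
            gen A ħ η₁ c₁ (.H (-1) i (u + Complex.I * ħ * c₁ / 4)) ⊗ₜ[DeltaRing]
              gen A ħ η₂ c₂ (.H 1 i (u + Complex.I * ħ * c₁ / 2 - Complex.I * ħ * c₂ / 4)) := by
      refine delta_smul_congr fun hz => ?_
      rw [show v + Complex.I * ħ * c₂ / 2 - Complex.I * ħ * c₁ / 4 =
          u + Complex.I * ħ * c₁ / 4 by linear_combination -hz,
        show v + Complex.I * ħ * c₂ / 4 =
          u + Complex.I * ħ * c₁ / 2 - Complex.I * ħ * c₂ / 4 by linear_combination -hz]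
    rw [hmid, hp, hm, hcancel, sub_add_sub_cancel]
    congr 1
    · refine delta_smul_congr fun hz => ?_
      congr 3
      · ring
      · linear_combination -hz
    · refine delta_smul_congr fun hz => ?_
      congr 3
      · linear_combination hz
      · ring
  · simp

end Comul

/-! ### The Serre-like relations -/

/-- The identity behind the Serre relation: the contribution of the ordering `X₁ X₂` is, up to a
common factor, `sh (x - y + 2b)`, and that of the ordering `X₂ X₁` is obtained by exchanging `x`
and `y`. -/
theorem sinh_serre_identity (x y b : ℂ) :
    (Complex.sinh (x + b) * Complex.sinh (y + b) -
          2 * Complex.cosh (2 * b) * (Complex.sinh (x + b) * Complex.sinh (y - b)) +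
        Complex.sinh (x - b) * Complex.sinh (y - b)) * Complex.sinh (y - x + 2 * b) +
      Complex.sinh (y - x - 2 * b) *
        (Complex.sinh (x + b) * Complex.sinh (y + b) -
            2 * Complex.cosh (2 * b) * (Complex.sinh (x - b) * Complex.sinh (y + b)) +
          Complex.sinh (x - b) * Complex.sinh (y - b)) = 0 := by
  rw [show (2 : ℂ) * b = b + b by ring]
  simp only [Complex.sinh, Complex.cosh, Complex.exp_add, Complex.exp_sub, Complex.exp_neg,
    neg_add, neg_sub]
  have hx := Complex.exp_ne_zero x
  have hy := Complex.exp_ne_zero y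
  have hb := Complex.exp_ne_zero b
  field_simp
  ring

/-- Away from the zeros and poles of the structure functions every ordering of `X₁ X₂ Y` is a
scalar multiple of `Y X₁ X₂`, and the scalars in the Serre-like relation add up to zero. The sign
of `b` distinguishes the currents `E` and `F`. -/
theorem serre_eq_zero {S : Type*} [Ring S] [Algebra DeltaRing S] {X₁ X₂ Y : S} {ħ η : ℝ}
    {x y b : ℂ} (hb : Complex.cosh (Real.pi * η * (2 * b)) = Complex.cos (Real.pi * η * ħ))
    (h₁₂ : ExchangeRel X₂ X₁ (shRatio η (y - x - 2 * b) (y - x + 2 * b)))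
    (h₁ : ExchangeRel X₁ Y (shRatio η (x + b) (x - b)))
    (h₂ : ExchangeRel X₂ Y (shRatio η (y + b) (y - b)))
    (hxy : sh η (y - x + 2 * b) ≠ 0) (hx : sh η (x - b) ≠ 0) (hy : sh η (y - b) ≠ 0) :
    serre ħ η X₁ X₂ Y = 0 := by
  have e₁₂ := h₁₂.mul_eq _ (tendsto_shRatio η _ hxy)
  have e₁ := h₁.mul_eq _ (tendsto_shRatio η _ hx)
  have e₂ := h₂.mul_eq _ (tendsto_shRatio η _ hy)
  have key := sinh_serre_identity (Real.pi * η * x) (Real.pi * η * y) (Real.pi * η * b)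
  rw [show 2 * (Real.pi * η * b : ℂ) = Real.pi * η * (2 * b) by ring, hb] at key
  simp only [← mul_add, ← mul_sub] at key
  change (sh η (x + b) * sh η (y + b) - _ * (sh η (x + b) * sh η (y - b)) +
    sh η (x - b) * sh η (y - b)) * sh η (y - x + 2 * b) + sh η (y - x - 2 * b) *
    (sh η (x + b) * sh η (y + b) - _ * (sh η (x - b) * sh η (y + b)) +
      sh η (x - b) * sh η (y - b)) = 0 at key
  have hscal : sh η (x + b) / sh η (x - b) * (sh η (y + b) / sh η (y - b)) -
        2 * Complex.cos (Real.pi * η * ħ) * (sh η (x + b) / sh η (x - b)) + 1 +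
      sh η (y - x - 2 * b) / sh η (y - x + 2 * b) *
        (sh η (x + b) / sh η (x - b) * (sh η (y + b) / sh η (y - b)) -
          2 * Complex.cos (Real.pi * η * ħ) * (sh η (y + b) / sh η (y - b)) + 1) = 0 := by
    generalize sh η (y - x + 2 * b) = d, sh η (y - x - 2 * b) = d', sh η (x - b) = d₁,
      sh η (y - b) = d₂ at *
    field_simp
    linear_combination key
  generalize sh η (x + b) / sh η (x - b) = g₁ at e₁ hscal
  generalize sh η (y + b) / sh η (y - b) = g₂ at e₂ hscal
  generalize sh η (y - x - 2 * b) / sh η (y - x + 2 * b) = h at e₁₂ hscal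
  have m₁ : X₁ * Y * X₂ = (Polynomial.C g₁ : DeltaRing) • (Y * X₁ * X₂) := by
    rw [e₁, smul_mul_assoc]
  have m₂ : Y * X₂ * X₁ = (Polynomial.C h : DeltaRing) • (Y * X₁ * X₂) := by
    rw [mul_assoc, e₁₂, mul_smul_comm, mul_assoc]
  have m₃ : X₂ * Y * X₁ = (Polynomial.C (g₂ * h) : DeltaRing) • (Y * X₁ * X₂) := by
    rw [e₂, smul_mul_assoc, m₂, smul_smul, map_mul]
  have m₄ : X₁ * X₂ * Y = (Polynomial.C (g₂ * g₁) : DeltaRing) • (Y * X₁ * X₂) := by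
    rw [mul_assoc, e₂, mul_smul_comm, ← mul_assoc, m₁, smul_smul, map_mul]
  have m₅ : X₂ * X₁ * Y = (Polynomial.C (h * (g₂ * g₁)) : DeltaRing) • (Y * X₁ * X₂) := by
    rw [e₁₂, smul_mul_assoc, m₄, smul_smul, map_mul _ h]
  rw [serre, m₁, m₂, m₃, m₄, m₅, smul_smul, smul_smul, ← map_mul, ← map_mul, ← sub_smul,
    ← sub_smul]
  nth_rw 2 [← one_smul DeltaRing (Y * X₁ * X₂)]
  rw [← add_smul, ← add_smul, ← add_smul, ← map_one Polynomial.C, ← map_sub, ← map_sub,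
    ← map_add, ← map_add, ← map_add]
  convert zero_smul DeltaRing (Y * X₁ * X₂)
  rw [Polynomial.C_eq_zero]
  linear_combination hscal

theorem cosh_pi_mul_I (ħ η : ℝ) :
    Complex.cosh (Real.pi * η * (2 * (Complex.I * ħ / 2))) = Complex.cos (Real.pi * η * ħ) := by
  rw [← Complex.cosh_mul_I]
  ring_nf

section Comul

variable {ι : Type*} [DecidableEq ι] (A : Matrix ι ι ℤ) (ħ : ℝ) {η₁ η₂ η₃ : ℝ} (c₁ c₂ : ℝ)

theorem serre_comul_E (hdiag : ∀ i, A i i = 2) (hA : A.IsSymm) (h₁ : η₁ ≠ 0) (h₂ : η₂ ≠ 0)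
    (h₁₂ : etaPrime ħ η₁ c₁ = η₂) {i j : ι} (hij : A i j = -1) {u₁ u₂ v : ℂ}
    (hu : Regular ħ η₁ (B A i i) (u₁ - u₂)) (hu₁ : Regular ħ η₁ (B A i j) (u₁ - v))
    (hu₂ : Regular ħ η₁ (B A i j) (u₂ - v)) :
    serre ħ η₁ (comul A ħ η₁ c₁ η₂ c₂ (.E i u₁)) (comul A ħ η₁ c₁ η₂ c₂ (.E i u₂))
      (comul A ħ η₁ c₁ η₂ c₂ (.E j v)) = 0 := by
  rw [Regular, B_self (hdiag i)] at hu
  rw [Regular, B_of_neg_one hij] at hu₁ hu₂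
  refine serre_eq_zero (x := u₁ - v) (y := u₂ - v) (b := Complex.I * ħ / 2) (cosh_pi_mul_I ħ η₁)
    (exchangeRel_comul_EE A ħ c₁ c₂ hA h₁ h₂ h₁₂ i i ?_ ?_)
    (exchangeRel_comul_EE A ħ c₁ c₂ hA h₁ h₂ h₁₂ i j ?_ ?_)
    (exchangeRel_comul_EE A ħ c₁ c₂ hA h₁ h₂ h₁₂ i j ?_ ?_) ?_ ?_ ?_
  · rw [B_self (hdiag i)]; ring
  · rw [B_self (hdiag i)]; ring
  · rw [B_of_neg_one hij]; ring
  · rw [B_of_neg_one hij]; ring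
  · rw [B_of_neg_one hij]; ring
  · rw [B_of_neg_one hij]; ring
  · rw [← neg_ne_zero, ← sh_neg]
    convert hu.1 using 2
    ring
  · convert hu₁.2 using 2
    ring
  · convert hu₂.2 using 2
    ring

theorem serre_comul_F (hdiag : ∀ i, A i i = 2) (hA : A.IsSymm) (h₂ : η₂ ≠ 0) (h₃ : η₃ ≠ 0)
    (h₁₂ : etaPrime ħ η₁ c₁ = η₂) (h₂₃ : etaPrime ħ η₂ c₂ = η₃) {i j : ι} (hij : A i j = -1)
    {u₁ u₂ v : ℂ} (hu : Regular ħ η₃ (B A i i) (u₁ - u₂))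
    (hu₁ : Regular ħ η₃ (B A i j) (u₁ - v)) (hu₂ : Regular ħ η₃ (B A i j) (u₂ - v)) :
    serre ħ η₃ (comul A ħ η₁ c₁ η₂ c₂ (.F i u₁)) (comul A ħ η₁ c₁ η₂ c₂ (.F i u₂))
      (comul A ħ η₁ c₁ η₂ c₂ (.F j v)) = 0 := by
  rw [Regular, B_self (hdiag i)] at hu
  rw [Regular, B_of_neg_one hij] at hu₁ hu₂
  refine serre_eq_zero (x := u₁ - v) (y := u₂ - v) (b := -(Complex.I * ħ / 2)) ?_
    (exchangeRel_comul_FF A ħ c₁ c₂ hA h₂ h₃ h₁₂ h₂₃ i i ?_ ?_)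
    (exchangeRel_comul_FF A ħ c₁ c₂ hA h₂ h₃ h₁₂ h₂₃ i j ?_ ?_)
    (exchangeRel_comul_FF A ħ c₁ c₂ hA h₂ h₃ h₁₂ h₂₃ i j ?_ ?_) ?_ ?_ ?_
  · rw [mul_neg, mul_neg, Complex.cosh_neg, cosh_pi_mul_I]
  · rw [B_self (hdiag i)]; ring
  · rw [B_self (hdiag i)]; ring
  · rw [B_of_neg_one hij]; ring
  · rw [B_of_neg_one hij]; ring
  · rw [B_of_neg_one hij]; ring
  · rw [B_of_neg_one hij]; ring
  · rw [← neg_ne_zero, ← sh_neg]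
    convert hu.2 using 2
    ring
  · convert hu₁.1 using 2
    ring
  · convert hu₂.1 using 2
    ring

/-! ### The comultiplication -/

theorem comul_c : comul A ħ η₁ c₁ η₂ c₂ .c =
    algebraMap DeltaRing _ (Polynomial.C ((c₁ + c₂ : ℝ) : ℂ)) := by
  simp only [comul, gen_c, Complex.ofReal_add, map_add, Algebra.TensorProduct.algebraMap_apply]
  congr 1
  rw [Algebra.algebraMap_eq_smul_one, Algebra.algebraMap_eq_smul_one, TensorProduct.tmul_smul,
    TensorProduct.smul_tmul']

theorem exists_exchangeRel_comul (hA : A.IsSymm) (h₁ : η₁ ≠ 0) (h₂ : η₂ ≠ 0) (h₃ : η₃ ≠ 0)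
    (h₁₂ : etaPrime ħ η₁ c₁ = η₂) (h₂₃ : etaPrime ħ η₂ c₂ = η₃)
    (h₁₃ : etaPrime ħ η₁ (c₁ + c₂) = η₃) {X Y : Gen ι} {f : ℂ → ℂ} {x : ℂ}
    (hf : Exch A ħ η₁ (c₁ + c₂) X Y f x) :
    ∃ g, (∀ t, f (x + t) = g t) ∧
      ExchangeRel (comul A ħ η₁ c₁ η₂ c₂ X) (comul A ħ η₁ c₁ η₂ c₂ Y) g := by
  cases hf with
  | HpHm i j u v =>
    refine ⟨_, fun t => ?_, exchangeRel_comul_HpHm A ħ c₁ c₂ h₁ h₂ h₃ h₁₂ h₂₃ i j u v⟩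
    simp only [shRatio, Pi.mul_apply, h₁₃]
    ring_nf
  | HH ε i j u v =>
    refine ⟨_, fun t => ?_, exchangeRel_comul_HH A ħ c₁ c₂ h₁ h₂ h₃ h₁₂ h₂₃ ε i j u v⟩
    simp only [shRatio, Pi.mul_apply, h₁₃]
    ring_nf
  | HE ε i j u v =>
    refine ⟨_, fun t => ?_, exchangeRel_comul_HE A ħ c₁ c₂ h₁ h₂ h₁₂ ε i j u v⟩
    simp only [shRatio]
    ring_nf
  | HF ε i j u v =>
    refine ⟨_, fun t => ?_, exchangeRel_comul_HF A ħ c₁ c₂ hA h₂ h₃ h₁₂ h₂₃ ε i j u v⟩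
    simp only [shRatio, h₁₃]
    ring_nf
  | EE i j u v =>
    refine ⟨_, fun t => ?_, exchangeRel_comul_EE A ħ c₁ c₂ hA h₁ h₂ h₁₂ i j rfl rfl⟩
    simp only [shRatio]
    ring_nf
  | FF i j u v =>
    refine ⟨_, fun t => ?_, exchangeRel_comul_FF A ħ c₁ c₂ hA h₂ h₃ h₁₂ h₂₃ i j rfl rfl⟩
    simp only [shRatio, h₁₃]
    ring_nf

theorem satisfiesRelations_comul (hdiag : ∀ i, A i i = 2) (hA : A.IsSymm) (h₁ : η₁ ≠ 0)
    (h₂ : η₂ ≠ 0) (h₃ : η₃ ≠ 0) (h₁₂ : etaPrime ħ η₁ c₁ = η₂) (h₂₃ : etaPrime ħ η₂ c₂ = η₃)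
    (h₁₃ : etaPrime ħ η₁ (c₁ + c₂) = η₃) :
    SatisfiesRelations A ħ η₁ (c₁ + c₂) (comul A ħ η₁ c₁ η₂ c₂) := by
  intro x y hxy
  cases hxy with
  | exchange hf hl =>
    obtain ⟨g, hfg, hg⟩ := exists_exchangeRel_comul A ħ c₁ c₂ hA h₁ h₂ h₃ h₁₂ h₂₃ h₁₃ hf
    simpa using hg.mul_eq _ ((tendsto_nhdsNE_zero_iff hfg _).2 hl)
  | exchange_pole hf hl =>
    obtain ⟨g, hfg, hg⟩ := exists_exchangeRel_comul A ħ c₁ c₂ hA h₁ h₂ h₃ h₁₂ h₂₃ h₁₃ hf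
    simpa using hg.mul_eq_zero ((tendsto_nhdsNE_zero_iff hfg _).2 hl)
  | EF i j u v =>
    have h := comul_EF A ħ c₁ c₂ hA h₂ h₁₂ i j u v
    split_ifs at h ⊢ with hij <;>
    · simp only [map_sub, map_mul, map_smul, map_zero, FreeAlgebra.lift_ι_apply]
      exact h
  | serreE i j hij u₁ u₂ v hu hu₁ hu₂ =>
    rw [map_zero, ← serre_comul_E A ħ c₁ c₂ hdiag hA h₁ h₂ h₁₂ hij hu hu₁ hu₂]
    simp only [serre, map_add, map_sub, map_mul, map_smul, FreeAlgebra.lift_ι_apply]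
  | serreF i j hij u₁ u₂ v hu hu₁ hu₂ =>
    rw [h₁₃] at hu hu₁ hu₂ ⊢
    rw [map_zero, ← serre_comul_F A ħ c₁ c₂ hdiag hA h₂ h₃ h₁₂ h₂₃ hij hu hu₁ hu₂]
    simp only [serre, map_add, map_sub, map_mul, map_smul, FreeAlgebra.lift_ι_apply]
  | central g =>
    rw [map_mul, map_mul, FreeAlgebra.lift_ι_apply, comul_c]
    exact Algebra.commutes _ _
  | level =>
    rw [FreeAlgebra.lift_ι_apply, comul_c, AlgHom.commutes]

/-- A family satisfying the defining relations extends uniquely from the generators. -/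
theorem existsUnique_algHom {η c : ℝ} {S : Type*} [Ring S] [Algebra DeltaRing S] {φ : Gen ι → S}
    (h : SatisfiesRelations A ħ η c φ) :
    ∃! Δ : Alg A ħ η c →ₐ[DeltaRing] S, ∀ g, Δ (gen A ħ η c g) = φ g := by
  refine ⟨RingQuot.liftAlgHom DeltaRing ⟨FreeAlgebra.lift DeltaRing φ, @h⟩, fun g => ?_,
    fun Δ hΔ => ?_⟩
  · exact (RingQuot.liftAlgHom_mkAlgHom_apply _ _ _ _).trans (FreeAlgebra.lift_ι_apply _ _)
  · refine RingQuot.liftAlgHom_unique _ _ _ _ ?_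
    refine FreeAlgebra.hom_ext (funext fun g => ?_)
    exact (hΔ g).trans (FreeAlgebra.lift_ι_apply _ _).symm

end Comul

theorem etaPrime_eq {ħ η c η' : ℝ} (h : 1 / η' - 1 / η = ħ * c) : etaPrime ħ η c = η' := by
  rw [etaPrime, ← h, add_sub_cancel, one_div, inv_inv]

end CurrentAlgebra

theorem proposition2 {ι : Type*} [Fintype ι] [DecidableEq ι] (A : Matrix ι ι ℤ)
    (hdiag : ∀ i, A i i = 2) (hsymm : A.IsSymm) (hA : A.IsSimplyLaced)
    (ħ : ℝ) (hħ : ħ ≠ 0) (η c : ℤ → ℝ) (hη : ∀ n, η n ≠ 0)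
    (hηc : ∀ n, 1 / η (n + 1) - 1 / η n = ħ * c n) (n : ℤ) :
    (CurrentAlgebra.SatisfiesRelations A ħ (η n) (c n + c (n + 1))
        (CurrentAlgebra.comulPlus A ħ η c n) ∧
      ∃! Δ : CurrentAlgebra.Alg A ħ (η n) (c n + c (n + 1)) →ₐ[CurrentAlgebra.DeltaRing]
          CurrentAlgebra.Alg A ħ (η n) (c n) ⊗[CurrentAlgebra.DeltaRing]
            CurrentAlgebra.Alg A ħ (η (n + 1)) (c (n + 1)),
        ∀ g, Δ (CurrentAlgebra.gen A ħ (η n) (c n + c (n + 1)) g) =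
          CurrentAlgebra.comulPlus A ħ η c n g) ∧
    (CurrentAlgebra.SatisfiesRelations A ħ (η (n - 1)) (c (n - 1) + c n)
        (CurrentAlgebra.comulMinus A ħ η c n) ∧
      ∃! Δ : CurrentAlgebra.Alg A ħ (η (n - 1)) (c (n - 1) + c n) →ₐ[CurrentAlgebra.DeltaRing]
          CurrentAlgebra.Alg A ħ (η (n - 1)) (c (n - 1)) ⊗[CurrentAlgebra.DeltaRing]
            CurrentAlgebra.Alg A ħ (η n) (c n),
        ∀ g, Δ (CurrentAlgebra.gen A ħ (η (n - 1)) (c (n - 1) + c n) g) =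
          CurrentAlgebra.comulMinus A ħ η c n g) := by
  have main (m : ℤ) : CurrentAlgebra.SatisfiesRelations A ħ (η m) (c m + c (m + 1))
      (CurrentAlgebra.comulPlus A ħ η c m) := by
    refine CurrentAlgebra.satisfiesRelations_comul A ħ (c m) (c (m + 1)) hdiag hsymm (hη m)
      (hη (m + 1)) (hη (m + 1 + 1)) (CurrentAlgebra.etaPrime_eq (hηc m))
      (CurrentAlgebra.etaPrime_eq (hηc (m + 1))) (CurrentAlgebra.etaPrime_eq ?_)
    linear_combination hηc m + hηc (m + 1)
  have main' : CurrentAlgebra.SatisfiesRelations A ħ (η (n - 1)) (c (n - 1) + c n)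
      (CurrentAlgebra.comulMinus A ħ η c n) := by
    have h := main (n - 1)
    unfold CurrentAlgebra.comulPlus at h
    rwa [sub_add_cancel] at h
  exact ⟨⟨main n, CurrentAlgebra.existsUnique_algHom A ħ (main n)⟩,
    main', CurrentAlgebra.existsUnique_algHom A ħ main'⟩
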